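/- Let $\mathbb{D}$ be the open unit disc and let $H^2(\mathbb{D})$ be the Hardy space of all functions $f(z)=\sum_{n\ge 0}a_nz^n$ on $\mathbb{D}$ with $\|f\|^2=\sum_{n\ge 0}|a_n|^2<\infty$, a Hilbert space with inner product $\langle \sum a_nz^n,\sum b_nz^n\rangle=\sum a_n\overline{b_n}$. For $|\mu|=1$ let $J_\mu$ be the conjugation $(J_\mu f)(z)=\overline{f(\mu\bar z)}$ on $H^2(\mathbb{D})$, and let $J=J_1$. For a conjugation $C$ (a conjugate-linear map with $\langle Cx,Cy\rangle=\langle y,x\rangle$ and $C^2=I$), a bounded operator $T$ is called $C$-normal if $CT^*TC=TT^*$; it is called normal if $TT^*=T^*T$. Let $a,b,c,d\in\mathbb{C}$ be such that $cz+d\ne 0$ and $\left|\frac{az+b}{cz+d}\right|<1$ for all $z\in\mathbb{D}$, and let $\varphi(z)=\frac{az+b}{cz+d}$ be the resulting linear fractional self-map of $\mathbb{D}$ (constant maps, $ad-bc=0$, are allowed). Then there is exactly one bounded linear operator $C_\varphi$ on $H^2(\mathbb{D})$ with $C_\varphi f=f\circ\varphi$ for all $f\in H^2(\mathbb{D})$,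 and for every $\mu\in\mathbb{C}$ with $|\mu|=1$ the following are equivalent: (i) $C_\varphi$ is normal; (ii) $C_\varphi$ is $J$-normal; (iii) $C_\varphi$ is $J_\mu$-normal. -/

import Mathlib

open scoped Complex.UnitDisc ComplexConjugate

noncomputable section

namespace Hardy

/-- The power series with square-summable coefficient sequence `a` converges on `𝔻` to `f`. -/
def HasCoeffs (f : 𝔻 → ℂ) (a : ℕ → ℂ) : Prop :=
  Summable (fun n => ‖a n‖ ^ 2) ∧ ∀ z : 𝔻, HasSum (fun n => a n * (z : ℂ) ^ n) (f z)

theorem memlp_of_summable {a : ℕ → ℂ} (ha : Summable fun n => ‖a n‖ ^ 2) : Memℓp a 2 := by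
  apply memℓp_gen
  simpa using ha

theorem summable_of_memlp {a : ℕ → ℂ} (ha : Memℓp a 2) : Summable fun n => ‖a n‖ ^ 2 := by
  simpa using ha.summable (by norm_num)

theorem HasCoeffs.add {f g : 𝔻 → ℂ} {a b : ℕ → ℂ} (hf : HasCoeffs f a) (hg : HasCoeffs g b) :
    HasCoeffs (f + g) (a + b) := by
  refine ⟨summable_of_memlp ((memlp_of_summable hf.1).add (memlp_of_summable hg.1)), fun z => ?_⟩
  simpa [add_mul] using (hf.2 z).add (hg.2 z)

theorem HasCoeffs.smul {f : 𝔻 → ℂ} {a : ℕ → ℂ} (c : ℂ) (hf : HasCoeffs f a) :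
    HasCoeffs (c • f) (c • a) := by
  refine ⟨summable_of_memlp ((memlp_of_summable hf.1).const_smul c), fun z => ?_⟩
  simpa [mul_assoc] using (hf.2 z).mul_left c

theorem HasCoeffs.unique {f : 𝔻 → ℂ} {a b : ℕ → ℂ} (ha : HasCoeffs f a) (hb : HasCoeffs f b) :
    a = b := by
  classical
  let F : ℂ → ℂ := fun z => if h : ‖z‖ < 1 then f (Complex.UnitDisc.mk z h) else 0
  have key : ∀ c : ℕ → ℂ, HasCoeffs f c →
      HasFPowerSeriesAt F (FormalMultilinearSeries.ofScalars ℂ c) 0 := by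
    intro c hc
    rw [hasFPowerSeriesAt_iff]
    filter_upwards [Metric.ball_mem_nhds (0 : ℂ) one_pos] with z hz
    have hz' : ‖z‖ < 1 := by simpa using hz
    have := hc.2 (Complex.UnitDisc.mk z hz')
    simpa [F, hz', FormalMultilinearSeries.coeff_ofScalars, mul_comm] using this
  have h := (key a ha).eq_formalMultilinearSeries (key b hb)
  funext n
  have := congrArg (fun p => FormalMultilinearSeries.coeff p n) h
  simpa [FormalMultilinearSeries.coeff_ofScalars] using this

/-- The functions on the disc that are sums of power series with square-summable coefficients. -/
def hardySubmodule : Submodule ℂ (𝔻 → ℂ) where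
  carrier := {f | ∃ a, HasCoeffs f a}
  add_mem' := by
    rintro f g ⟨a, ha⟩ ⟨b, hb⟩
    exact ⟨a + b, ha.add hb⟩
  zero_mem' := ⟨0, by simp [HasCoeffs]⟩
  smul_mem' := by
    rintro c f ⟨a, ha⟩
    exact ⟨c • a, ha.smul c⟩

/-- The Hardy space `H²(𝔻)`. It is a separate type so that it carries the Hardy norm and not the
topology of pointwise convergence. -/
def HardySpace : Type := hardySubmodule

namespace HardySpace

instance : AddCommGroup HardySpace := inferInstanceAs (AddCommGroup hardySubmodule)

instance : Module ℂ HardySpace := inferInstanceAs (Module ℂ hardySubmodule)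

instance : CoeFun HardySpace (fun _ => 𝔻 → ℂ) := ⟨fun f => f.1⟩

/-- The Taylor coefficients at the origin. -/
def coeff (f : HardySpace) : ℕ → ℂ := Classical.choose f.2

theorem hasCoeffs_coeff (f : HardySpace) : HasCoeffs f f.coeff := Classical.choose_spec f.2

theorem coeff_eq {f : HardySpace} {a : ℕ → ℂ} (h : HasCoeffs f a) : f.coeff = a :=
  f.hasCoeffs_coeff.unique h

@[ext] theorem ext {f g : HardySpace} (h : ∀ z, f z = g z) : f = g := Subtype.ext (funext h)

/-- The coefficient map from `H²(𝔻)` to `ℓ²`. -/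
def coeffₗ : HardySpace →ₗ[ℂ] lp (fun _ : ℕ => ℂ) 2 where
  toFun f := ⟨f.coeff, memlp_of_summable f.hasCoeffs_coeff.1⟩
  map_add' f g := Subtype.ext (coeff_eq (f.hasCoeffs_coeff.add g.hasCoeffs_coeff))
  map_smul' c f := Subtype.ext (coeff_eq (f.hasCoeffs_coeff.smul c))

theorem coeffₗ_injective : Function.Injective coeffₗ := by
  intro f g h
  have h' : f.coeff = g.coeff := congrArg Subtype.val h
  ext z
  have hf := f.hasCoeffs_coeff.2 z
  rw [h'] at hf
  exact hf.unique (g.hasCoeffs_coeff.2 z)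

theorem coeffₗ_surjective : Function.Surjective coeffₗ := by
  intro a
  have h2 : Summable fun n => ‖(a : ℕ → ℂ) n‖ ^ 2 := summable_of_memlp a.2
  have hs : ∀ z : 𝔻, Summable fun n => (a : ℕ → ℂ) n * (z : ℂ) ^ n := by
    intro z
    have hz : Summable fun n : ℕ => (‖(z : ℂ)‖ ^ 2) ^ n :=
      summable_geometric_of_lt_one (by positivity) z.sq_norm_lt_one
    refine Summable.of_norm_bounded (h2.add hz) fun n => ?_
    rw [norm_mul, norm_pow, ← pow_mul, mul_comm 2 n, pow_mul]
    nlinarith [sq_nonneg (‖(a : ℕ → ℂ) n‖ - ‖(z : ℂ)‖ ^ n),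
      sq_nonneg (‖(a : ℕ → ℂ) n‖ + ‖(z : ℂ)‖ ^ n)]
  have hc : HasCoeffs (fun z => ∑' n, (a : ℕ → ℂ) n * (z : ℂ) ^ n) a :=
    ⟨h2, fun z => (hs z).hasSum⟩
  exact ⟨⟨_, _, hc⟩, Subtype.ext (coeff_eq hc)⟩

/-- The norm is `‖f‖² = ∑ |aₙ|²`, see `norm_sq_eq`. -/
instance : NormedAddCommGroup HardySpace :=
  NormedAddCommGroup.induced HardySpace (lp (fun _ : ℕ => ℂ) 2) coeffₗ coeffₗ_injective

instance : InnerProductSpace ℂ HardySpace := InnerProductSpace.induced coeffₗ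

theorem inner_eq (f g : HardySpace) :
    inner ℂ f g = ∑' n, conj (f.coeff n) * g.coeff n := by
  change inner ℂ (coeffₗ f) (coeffₗ g) = _
  rw [lp.inner_eq_tsum]
  refine tsum_congr fun n => ?_
  simp [coeffₗ, mul_comm]

theorem norm_sq_eq (f : HardySpace) : ‖f‖ ^ 2 = ∑' n, ‖f.coeff n‖ ^ 2 := by
  change ‖coeffₗ f‖ ^ 2 = _
  have := lp.norm_rpow_eq_tsum (p := 2) (by norm_num) (coeffₗ f)
  simp only [ENNReal.toReal_ofNat, Real.rpow_ofNat] at this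
  exact this

instance : CompleteSpace HardySpace := by
  have hi : Isometry coeffₗ := AddMonoidHomClass.isometry_of_norm coeffₗ fun _ => rfl
  exact ((IsometryEquiv.mk (Equiv.ofBijective coeffₗ ⟨coeffₗ_injective, coeffₗ_surjective⟩)
    hi).completeSpace_iff).2 inferInstance

end HardySpace

/-- A conjugation on a complex inner product space. -/
structure Conjugation (H : Type*) [NormedAddCommGroup H] [InnerProductSpace ℂ H] where
  toFun : H →ₛₗ[starRingEnd ℂ] H
  inner_map_map : ∀ x y, inner ℂ (toFun x) (toFun y) = inner ℂ y x
  involutive : ∀ x, toFun (toFun x) = x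

instance {H : Type*} [NormedAddCommGroup H] [InnerProductSpace ℂ H] :
    CoeFun (Conjugation H) (fun _ => H → H) := ⟨fun C => C.toFun⟩

/-- `T` is `C`-normal: `C T* T C = T T*`. -/
def IsCNormal {H : Type*} [NormedAddCommGroup H] [InnerProductSpace ℂ H] [CompleteSpace H]
    (C : Conjugation H) (T : H →L[ℂ] H) : Prop :=
  ∀ x, C (ContinuousLinearMap.adjoint T (T (C x))) = T (ContinuousLinearMap.adjoint T x)

theorem HasCoeffs.conj {f : 𝔻 → ℂ} {a : ℕ → ℂ} (μ : Circle) (hf : HasCoeffs f a) :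
    HasCoeffs (fun z => conj (f (μ • star z))) (fun n => conj (a n * (μ : ℂ) ^ n)) := by
  refine ⟨by simpa [Circle.norm_coe] using hf.1, fun z => ?_⟩
  have h := (hf.2 (μ • star z)).map (starRingEnd ℂ) Complex.continuous_conj
  convert h using 2 with n
  simp [mul_pow, mul_assoc]

/-- The conjugate-linear map `(J_μ f)(z) = conj (f (μ * conj z))` on `H²(𝔻)`. -/
def conjJFun (μ : Circle) : HardySpace →ₛₗ[starRingEnd ℂ] HardySpace where
  toFun f := ⟨fun z => conj (f (μ • star z)), _, f.hasCoeffs_coeff.conj μ⟩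
  map_add' _ _ := HardySpace.ext fun _ => map_add (starRingEnd ℂ) _ _
  map_smul' _ _ := HardySpace.ext fun _ => map_mul (starRingEnd ℂ) _ _

theorem coeff_conjJFun (μ : Circle) (f : HardySpace) (n : ℕ) :
    (conjJFun μ f).coeff n = conj (f.coeff n * (μ : ℂ) ^ n) :=
  congrFun (HardySpace.coeff_eq (f := conjJFun μ f) (f.hasCoeffs_coeff.conj μ)) n

/-- The conjugation `J_μ` on `H²(𝔻)`. -/
def conjJ (μ : Circle) : Conjugation HardySpace where
  toFun := conjJFun μ
  inner_map_map f g := by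
    rw [HardySpace.inner_eq, HardySpace.inner_eq]
    refine tsum_congr fun n => ?_
    have hμ : (μ : ℂ) ^ n * conj ((μ : ℂ) ^ n) = 1 := by
      rw [Complex.mul_conj, map_pow]; simp
    rw [coeff_conjJFun, coeff_conjJFun, Complex.conj_conj, map_mul]
    linear_combination (f.coeff n * conj (g.coeff n)) * hμ
  involutive f := by
    ext z
    change conj (conj (f (μ • star (μ • star z)))) = f z
    have hz : μ • star (μ • star z) = z := by
      apply Complex.UnitDisc.coe_injective
      have hμ : (μ : ℂ) * conj (μ : ℂ) = 1 := by
        rw [Complex.mul_conj]; simp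
      simp only [Complex.UnitDisc.coe_circle_smul, Complex.UnitDisc.coe_star, map_mul,
        Complex.conj_conj]
      linear_combination (z : ℂ) * hμ
    rw [hz, Complex.conj_conj]

/-- The conjugation `(J f)(z) = conj (f (conj z))` on `H²(𝔻)`. -/
def conjOne : Conjugation HardySpace := conjJ 1

theorem conjJ_apply (μ : Circle) (f : HardySpace) (z : 𝔻) :
    conjJ μ f z = conj (f (μ • star z)) := rfl

theorem conjOne_apply (f : HardySpace) (z : 𝔻) : conjOne f z = conj (f (star z)) := by
  rw [conjOne, conjJ_apply, one_smul]

/-- `φ` is a linear fractional self-map of the disc (degenerate, that is constant, maps are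
included). -/
def IsLinearFractional (φ : 𝔻 → 𝔻) : Prop :=
  ∃ a b c d : ℂ, ∀ z : 𝔻, c * (z : ℂ) + d ≠ 0 ∧ (φ z : ℂ) = (a * (z : ℂ) + b) / (c * (z : ℂ) + d)

/-- `T` is the composition operator `C_φ`, that is `T f = f ∘ φ` for all `f ∈ H²(𝔻)`. -/
def IsCompositionOperator (φ : 𝔻 → 𝔻) (T : HardySpace →L[ℂ] HardySpace) : Prop :=
  ∀ (f : HardySpace) (z : 𝔻), T f z = f (φ z)

end Hardy

end

open scoped Complex.UnitDisc ComplexConjugate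

noncomputable section

namespace Hardy

/-! Each of the three conditions says that `φ z = l * z` for a constant `l`. Normality and
`J_μ`-normality both give `‖T e‖ = ‖T* e‖` for every monomial `e`, since `J_μ` only rescales `e` by
a unimodular factor. For `e = 1`, `T 1 = 1` and `T* 1` is the kernel at `φ 0`, which has norm 1 only
if `φ 0 = 0`. For `e = z`, the chain rule at 0 gives `T* z = conj l * z` with `l = φ'(0)`, so `‖φ‖ =
|l|` and no other coefficient of `φ` survives (`eq_mul_of_norm_eq`). Conversely `z ↦ l * z` makes
`T` diagonal.

The linear fractional form serves boundedness. If multiplication by `ψ` is a contraction `V` and `ψ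
p = 0`, then `kernel p` is orthogonal to the range of `V`, and a Bessel inequality for its orbit
bounds `f ↦ kernel p * (f ∘ ψ)` (`exists_kernel_mul_comp`). This covers disc involutions and maps
fixing 0, and `φ` is a composite of two such maps. -/

theorem ofReal_norm_sq {H : Type*} [NormedAddCommGroup H] [InnerProductSpace ℂ H] (x : H) :
    ((‖x‖ ^ 2 : ℝ) : ℂ) = inner ℂ x x := by
  rw [Complex.ofReal_pow]
  exact (inner_self_eq_norm_sq_to_K x).symm

/-! ### Kernels, monomials and the shift -/

namespace HardySpace

@[simp] theorem sub_apply (f g : HardySpace) (z : 𝔻) : (f - g) z = f z - g z := rfl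

@[simp] theorem smul_apply (c : ℂ) (f : HardySpace) (z : 𝔻) : (c • f) z = c * f z := rfl

@[simp] theorem coeff_add (f g : HardySpace) (n : ℕ) :
    (f + g).coeff n = f.coeff n + g.coeff n :=
  congrFun (congrArg Subtype.val (coeffₗ.map_add f g)) n

@[simp] theorem coeff_smul (c : ℂ) (f : HardySpace) (n : ℕ) :
    (c • f).coeff n = c * f.coeff n :=
  congrFun (congrArg Subtype.val (coeffₗ.map_smul c f)) n

theorem ext_coeff {f g : HardySpace} (h : ∀ n, f.coeff n = g.coeff n) : f = g :=
  coeffₗ_injective (Subtype.ext (funext h))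

/-- The element of `H²(𝔻)` with a given square-summable coefficient sequence. -/
def ofCoeffs (a : ℕ → ℂ) (ha : Summable fun n => ‖a n‖ ^ 2) : HardySpace :=
  Classical.choose (coeffₗ_surjective ⟨a, memlp_of_summable ha⟩)

@[simp] theorem coeff_ofCoeffs (a : ℕ → ℂ) (ha : Summable fun n => ‖a n‖ ^ 2) (n : ℕ) :
    (ofCoeffs a ha).coeff n = a n :=
  congrFun (congrArg Subtype.val
    (Classical.choose_spec (coeffₗ_surjective ⟨a, memlp_of_summable ha⟩))) n

theorem apply_eq_tsum (f : HardySpace) (z : 𝔻) : f z = ∑' n, f.coeff n * (z : ℂ) ^ n :=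
  (f.hasCoeffs_coeff.2 z).tsum_eq.symm

theorem summable_norm_coeff_sq (f : HardySpace) : Summable fun n => ‖f.coeff n‖ ^ 2 :=
  f.hasCoeffs_coeff.1

/-- The reproducing kernel `1 / (1 - conj w * z)` of `H²(𝔻)`. -/
def kernel (w : 𝔻) : HardySpace :=
  ofCoeffs (fun n => conj (w : ℂ) ^ n) <| by
    have := summable_geometric_of_lt_one (by positivity) w.sq_norm_lt_one
    refine this.congr fun n => ?_
    rw [norm_pow, RCLike.norm_conj, ← pow_mul, ← pow_mul, mul_comm]

@[simp] theorem coeff_kernel (w : 𝔻) (n : ℕ) : (kernel w).coeff n = conj (w : ℂ) ^ n :=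
  coeff_ofCoeffs _ _ n

theorem inner_kernel (w : 𝔻) (f : HardySpace) : inner ℂ (kernel w) f = f w := by
  rw [inner_eq, apply_eq_tsum]
  refine tsum_congr fun n => ?_
  simp [mul_comm]

theorem norm_conj_mul_lt_one (w z : 𝔻) : ‖conj (w : ℂ) * z‖ < 1 := by
  simpa using (star w * z).norm_lt_one

theorem one_sub_conj_mul_ne_zero (w z : 𝔻) : 1 - conj (w : ℂ) * z ≠ 0 := by
  intro h
  have := norm_conj_mul_lt_one w z
  rw [← sub_eq_zero.1 h] at this
  simp at this

theorem kernel_apply (w z : 𝔻) : kernel w z = (1 - conj (w : ℂ) * z)⁻¹ := by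
  rw [apply_eq_tsum, ← tsum_geometric_of_norm_lt_one (norm_conj_mul_lt_one w z)]
  refine tsum_congr fun n => ?_
  rw [coeff_kernel, mul_pow]

theorem norm_kernel_sq (w : 𝔻) : ‖kernel w‖ ^ 2 = (1 - ‖(w : ℂ)‖ ^ 2)⁻¹ := by
  have h := ofReal_norm_sq (kernel w)
  rw [inner_kernel, kernel_apply, Complex.conj_mul'] at h
  exact_mod_cast h

/-- The monomial `z ^ n`. -/
def monomial (n : ℕ) : HardySpace :=
  ofCoeffs (Pi.single n 1) <| summable_of_ne_finset_zero (s := {n}) fun m hm => by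
    rw [Pi.single_eq_of_ne (by simpa using hm)]; simp

@[simp] theorem coeff_monomial (n : ℕ) : (monomial n).coeff = Pi.single n 1 :=
  funext (coeff_ofCoeffs _ _)

@[simp] theorem monomial_apply (n : ℕ) (z : 𝔻) : monomial n z = (z : ℂ) ^ n := by
  rw [apply_eq_tsum, tsum_eq_single n]
  · simp
  · intro m hm
    simp [hm]

theorem inner_monomial (n : ℕ) (f : HardySpace) : inner ℂ (monomial n) f = f.coeff n := by
  rw [inner_eq, tsum_eq_single n]
  · simp
  · intro m hm
    simp [hm]

theorem norm_monomial (n : ℕ) : ‖monomial n‖ = 1 := by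
  have h := ofReal_norm_sq (monomial n)
  rw [inner_monomial, coeff_monomial, Pi.single_eq_same] at h
  have h' : ‖monomial n‖ ^ 2 = 1 := by exact_mod_cast h
  nlinarith [norm_nonneg (monomial n)]

theorem kernel_zero : kernel 0 = monomial 0 := by
  ext z
  simp [kernel_apply]

theorem hasCoeffs_shift (f : HardySpace) :
    HasCoeffs (fun z => (z : ℂ) * f z) (fun n => Nat.casesOn n 0 f.coeff) := by
  refine ⟨(summable_nat_add_iff 1).1 f.summable_norm_coeff_sq, fun z => ?_⟩
  rw [← hasSum_nat_add_iff' 1]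
  simpa [pow_succ', mul_left_comm] using (f.hasCoeffs_coeff.2 z).mul_left (z : ℂ)

/-- Multiplication by `z` on `H²(𝔻)`. -/
def shift : HardySpace →ₗᵢ[ℂ] HardySpace where
  toFun f := ⟨fun z => (z : ℂ) * f z, _, hasCoeffs_shift f⟩
  map_add' _ _ := ext fun _ => mul_add _ _ _
  map_smul' _ _ := ext fun _ => mul_left_comm _ _ _
  norm_map' f := by
    rw [← sq_eq_sq₀ (norm_nonneg _) (norm_nonneg _), norm_sq_eq, norm_sq_eq]
    have h := hasCoeffs_shift f
    refine (tsum_congr fun n => congrArg (fun c : ℂ => ‖c‖ ^ 2)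
      (congrFun (coeff_eq (f := ⟨_, _, h⟩) h) n)).trans ?_
    rw [h.1.tsum_eq_zero_add]
    simp

@[simp] theorem shift_apply (f : HardySpace) (z : 𝔻) : shift f z = z * f z := rfl

/-- `f` extended by zero to the plane has derivative `f.coeff 1` at the origin. -/
theorem hasDerivAt_zero (f : HardySpace) :
    HasDerivAt (fun z : ℂ => if h : ‖z‖ < 1 then f (Complex.UnitDisc.mk z h) else 0)
      (f.coeff 1) 0 := by
  have key : HasFPowerSeriesAt
      (fun z : ℂ => if h : ‖z‖ < 1 then f (Complex.UnitDisc.mk z h) else 0)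
      (FormalMultilinearSeries.ofScalars ℂ f.coeff) 0 := by
    rw [hasFPowerSeriesAt_iff]
    filter_upwards [Metric.ball_mem_nhds (0 : ℂ) one_pos] with z hz
    have hz' : ‖z‖ < 1 := by simpa using hz
    have := f.hasCoeffs_coeff.2 (Complex.UnitDisc.mk z hz')
    simpa [hz', FormalMultilinearSeries.coeff_ofScalars, mul_comm] using this
  simpa [FormalMultilinearSeries.ofScalars] using key.hasDerivAt

/-- The operator `f ↦ ψ f` for `ψ z = (β + α z) / (1 - γ z)`. -/
theorem exists_multiplication {α β γ : ℂ} (hγ : ‖γ‖ < 1)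
    (h : ∀ g : HardySpace, ‖β • g + α • shift g‖ ≤ ‖g - γ • shift g‖) :
    ∃ V : HardySpace →L[ℂ] HardySpace, ‖V‖ ≤ 1 ∧
      ∀ f (z : 𝔻), (1 - γ * (z : ℂ)) * V f z = (β + α * z) * f z := by
  let S : HardySpace →L[ℂ] HardySpace := shift.toContinuousLinearMap
  have hS : ‖γ • S‖ < 1 := by
    rw [norm_smul]
    have : ‖S‖ ≤ 1 := shift.norm_toContinuousLinearMap_le
    nlinarith [norm_nonneg γ]
  obtain ⟨u, hu⟩ := isUnit_one_sub_of_norm_lt_one hS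
  let R : HardySpace →L[ℂ] HardySpace := ↑u⁻¹
  have hR : ∀ f, R f - γ • shift (R f) = f := by
    intro f
    have h1 : (1 - γ • S) * R = 1 := by rw [← hu]; exact u.mul_inv
    exact congrArg (fun A : HardySpace →L[ℂ] HardySpace => A f) h1
  refine ⟨(β • 1 + α • S) * R, ?_, fun f z => ?_⟩
  · refine ContinuousLinearMap.opNorm_le_bound _ zero_le_one fun f => ?_
    -- Since `R` inverts `1 - γ • S`, the hypothesis at `R f` is the contraction bound.
    have := h (R f)
    rw [hR] at this
    simpa [S] using this
  · have h1 := congrArg (fun g : HardySpace => g z) (hR f)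
    have h2 : ((β • 1 + α • S) * R) f z = β * R f z + α * (z * R f z) := rfl
    simp only [sub_apply, smul_apply, shift_apply] at h1
    rw [h2, ← h1]
    ring

end HardySpace

/-! ### Boundedness of composition operators -/

open ContinuousLinearMap HardySpace

/-- A Bessel inequality for the orbit of a vector orthogonal to the range of a contraction. -/
theorem sum_norm_inner_pow_le {H : Type*} [NormedAddCommGroup H] [InnerProductSpace ℂ H]
    [CompleteSpace H] {V : H →L[ℂ] H} (hV : ‖V‖ ≤ 1) {e : H}
    (he : ∀ x, inner ℂ e (V x) = 0) (N : ℕ) (x : H) :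
    ∑ n ∈ Finset.range N, ‖inner ℂ ((V ^ n) e) x‖ ^ 2 ≤ ‖e‖ ^ 2 * ‖x‖ ^ 2 := by
  have hstep : ∀ y, ‖inner ℂ e y‖ ^ 2 ≤ ‖e‖ ^ 2 * (‖y‖ ^ 2 - ‖adjoint V y‖ ^ 2) := by
    intro y
    set c : ℂ := inner ℂ e y
    set E : ℂ := ((‖e‖ ^ 2 : ℝ) : ℂ)
    have he' : adjoint V e = 0 := ext_inner_right ℂ fun v => by
      rw [adjoint_inner_left, he, inner_zero_left]
    rcases eq_or_ne e 0 with h0 | h0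
    · simp [c, h0]
    have hpos : 0 < ‖e‖ ^ 2 := by positivity
    -- The vector is `‖e‖ ^ 2` times the projection of `y` off `e`. As `V*` kills `e` and is a
    -- contraction, `V* y` is no longer than that projection.
    have h1 : ‖adjoint V (E • y - c • e)‖ ≤ ‖E • y - c • e‖ := by
      refine (le_opNorm _ _).trans ?_
      rw [LinearIsometryEquiv.norm_map]
      exact mul_le_of_le_one_left (norm_nonneg _) hV
    rw [map_sub, map_smul, map_smul, he', smul_zero, sub_zero, norm_smul] at h1
    have h2 : ‖E • y - c • e‖ ^ 2 = (‖e‖ ^ 2) ^ 2 * ‖y‖ ^ 2 - ‖e‖ ^ 2 * ‖c‖ ^ 2 := by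
      rw [@norm_sub_sq ℂ, inner_smul_left, inner_smul_right, norm_smul, norm_smul,
        ← inner_conj_symm y e]
      have : conj E * (c * conj c) = ((‖e‖ ^ 2 * ‖c‖ ^ 2 : ℝ) : ℂ) := by
        rw [Complex.mul_conj']; simp [E]
      rw [show conj E * (c * conj (inner ℂ e y)) = _ from this]
      have hE : ‖E‖ = ‖e‖ ^ 2 := by simp [E]
      rw [hE, RCLike.re_eq_complex_re, Complex.ofReal_re]
      ring
    have hE : ‖E‖ = ‖e‖ ^ 2 := by simp [E]
    rw [hE] at h1
    have h3 := pow_le_pow_left₀ (by positivity) h1 2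
    rw [h2] at h3
    have : ‖e‖ ^ 2 * ‖c‖ ^ 2 ≤ ‖e‖ ^ 2 * (‖e‖ ^ 2 * (‖y‖ ^ 2 - ‖adjoint V y‖ ^ 2)) := by
      nlinarith
    exact le_of_mul_le_mul_left this hpos
  induction N generalizing x with
  | zero => simp; positivity
  | succ N ih =>
    rw [Finset.sum_range_succ']
    have h1 := ih (adjoint V x)
    -- Moving one `V` across makes the sum telescope: `hstep` supplies what is lost from `x` to `V*
    -- x`.
    have h2 : ∀ n, inner ℂ ((V ^ (n + 1)) e) x = inner ℂ ((V ^ n) e) (adjoint V x) := by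
      intro n
      rw [pow_succ', adjoint_inner_right]
      rfl
    simp only [h2, pow_zero]
    have h3 := hstep x
    change _ + ‖inner ℂ e x‖ ^ 2 ≤ _
    linarith

/-- A weighted composition operator with weight a kernel function, obtained from multiplication
by a symbol vanishing at the point of the kernel function. -/
theorem exists_kernel_mul_comp {p : 𝔻} {ψ : 𝔻 → 𝔻} (hp : ψ p = 0)
    {V : HardySpace →L[ℂ] HardySpace} (hV : ‖V‖ ≤ 1) (hVψ : ∀ f z, V f z = ψ z * f z) :
    ∃ T : HardySpace →L[ℂ] HardySpace, ∀ f z, T f z = f (ψ z) * kernel p z := by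
  have hb := sum_norm_inner_pow_le hV (e := kernel p) fun x => by
    rw [inner_kernel, hVψ, hp]; simp
  have hs : ∀ g : HardySpace, Summable fun n => ‖inner ℂ ((V ^ n) (kernel p)) g‖ ^ 2 := fun g =>
    summable_of_sum_range_le (fun _ => by positivity) fun N => hb N g
  -- The adjoint of this analysis map sends `z ^ n` to `V ^ n (kernel p) = ψ ^ n * kernel p`.
  let A₀ : HardySpace →ₗ[ℂ] HardySpace :=
    { toFun g := ofCoeffs _ (hs g)
      map_add' f g := ext_coeff fun n => by simp
      map_smul' c g := ext_coeff fun n => by simp }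
  have hA₀ : ∀ g, ‖A₀ g‖ ≤ ‖kernel p‖ * ‖g‖ := by
    intro g
    rw [← sq_le_sq₀ (norm_nonneg _) (by positivity), norm_sq_eq, mul_pow]
    refine Real.tsum_le_of_sum_range_le (fun _ => by positivity) fun N => ?_
    simpa [A₀] using hb N g
  let A := A₀.mkContinuous _ hA₀
  have hA : ∀ g n, (A g).coeff n = inner ℂ ((V ^ n) (kernel p)) g := fun g n =>
    coeff_ofCoeffs _ (hs g) n
  have hpow : ∀ n z, (V ^ n) (kernel p) z = (ψ z : ℂ) ^ n * kernel p z := by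
    intro n z
    induction n with
    | zero => simp
    | succ n ih =>
      rw [pow_succ']
      change V ((V ^ n) (kernel p)) z = _
      rw [hVψ, ih]
      ring
  refine ⟨adjoint A, fun f z => ?_⟩
  rw [← inner_kernel, adjoint_inner_right, inner_eq, apply_eq_tsum, ← tsum_mul_right]
  refine tsum_congr fun n => ?_
  rw [hA, inner_conj_symm, inner_kernel, hpow]
  ring

theorem IsCompositionOperator.eq {φ : 𝔻 → 𝔻} {T T' : HardySpace →L[ℂ] HardySpace}
    (h : IsCompositionOperator φ T) (h' : IsCompositionOperator φ T') : T = T' := by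
  ext f z
  rw [h, h']

theorem IsCompositionOperator.mul {φ ψ : 𝔻 → 𝔻} {T U : HardySpace →L[ℂ] HardySpace}
    (hT : IsCompositionOperator φ T) (hU : IsCompositionOperator ψ U) :
    IsCompositionOperator (φ ∘ ψ) (U * T) := fun f z => by
  change U (T f) z = _
  rw [hU, hT]; rfl

/-- The squares differ by `(1 - |p|²)(1 - |z|²)`. -/
theorem norm_sub_lt_norm_one_sub_conj_mul (p z : 𝔻) :
    ‖(p : ℂ) - z‖ < ‖1 - conj (p : ℂ) * z‖ := by
  rw [← sq_lt_sq₀ (norm_nonneg _) (norm_nonneg _), @norm_sub_sq ℂ, @norm_sub_sq ℂ]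
  have h : (inner ℂ (1 : ℂ) (conj (p : ℂ) * z)) = inner ℂ (p : ℂ) (z : ℂ) := by
    simp [mul_comm]
  rw [h, norm_mul, RCLike.norm_conj, mul_pow, norm_one]
  nlinarith [p.sq_norm_lt_one, z.sq_norm_lt_one]

/-- The involutive automorphism `(p - z) / (1 - conj p * z)` of the disc. -/
def discInvolution (p z : 𝔻) : 𝔻 :=
  Complex.UnitDisc.mk (((p : ℂ) - z) / (1 - conj (p : ℂ) * z)) <| by
    rw [norm_div, div_lt_one (norm_pos_iff.2 (one_sub_conj_mul_ne_zero p z))]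
    exact norm_sub_lt_norm_one_sub_conj_mul p z

@[simp] theorem coe_discInvolution (p z : 𝔻) :
    (discInvolution p z : ℂ) = ((p : ℂ) - z) / (1 - conj (p : ℂ) * z) :=
  Complex.UnitDisc.coe_mk _ _

theorem discInvolution_mul (p z : 𝔻) :
    (discInvolution p z : ℂ) * (1 - conj (p : ℂ) * z) = p - z := by
  rw [coe_discInvolution, div_mul_cancel₀ _ (one_sub_conj_mul_ne_zero p z)]

theorem discInvolution_self (p : 𝔻) : discInvolution p p = 0 :=
  Complex.UnitDisc.coe_injective (by simp)

theorem discInvolution_involutive (p z : 𝔻) : discInvolution p (discInvolution p z) = z := by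
  apply Complex.UnitDisc.coe_injective
  refine mul_right_cancel₀ (one_sub_conj_mul_ne_zero p (discInvolution p z)) ?_
  rw [discInvolution_mul]
  refine mul_right_cancel₀ (one_sub_conj_mul_ne_zero p z) ?_
  linear_combination (conj (p : ℂ) * z - 1) * discInvolution_mul p z

theorem exists_isCompositionOperator_discInvolution (p : 𝔻) :
    ∃ T : HardySpace →L[ℂ] HardySpace, IsCompositionOperator (discInvolution p) T := by
  -- Equality of norms holds because the shift is isometric.
  obtain ⟨V, hV, hVf⟩ := exists_multiplication (α := -1) (β := p) (γ := conj (p : ℂ))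
    (by simpa using p.norm_lt_one) fun g => le_of_eq <| by
      rw [← sq_eq_sq₀ (norm_nonneg _) (norm_nonneg _), neg_one_smul, ← sub_eq_add_neg,
        @norm_sub_sq ℂ, @norm_sub_sq ℂ, inner_smul_left, inner_smul_right, norm_smul, norm_smul,
        RCLike.norm_conj, LinearIsometry.norm_map]
      ring
  obtain ⟨T, hT⟩ := exists_kernel_mul_comp (discInvolution_self p) hV fun f z => by
    rw [coe_discInvolution, div_mul_eq_mul_div, eq_div_iff (one_sub_conj_mul_ne_zero p z)]
    linear_combination hVf f z
  -- Multiplication by `1 - conj p * z` cancels the kernel weight.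
  refine ⟨(1 - conj (p : ℂ) • shift.toContinuousLinearMap) * T, fun f z => ?_⟩
  change T f z - conj (p : ℂ) * (z * T f z) = _
  rw [hT, kernel_apply]
  have := one_sub_conj_mul_ne_zero p z
  field_simp

/-- Contractivity comes from `|α| ‖g‖ ≤ (1 - |γ|) ‖g‖ ≤ ‖g - γ • shift g‖`; the weight `kernel 0` is
1. -/
theorem exists_isCompositionOperator_of_mul_eq {ψ : 𝔻 → 𝔻} {α γ : ℂ} (hα : ‖α‖ + ‖γ‖ ≤ 1)
    (hγ : ‖γ‖ < 1) (hψ : ∀ z, (ψ z : ℂ) * (1 - γ * z) = α * z) :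
    ∃ T : HardySpace →L[ℂ] HardySpace, IsCompositionOperator ψ T := by
  have hne : ∀ z : 𝔻, 1 - γ * (z : ℂ) ≠ 0 := fun z h => by
    have : ‖γ * (z : ℂ)‖ < 1 := by
      rw [norm_mul]; nlinarith [z.norm_lt_one, norm_nonneg γ, norm_nonneg (z : ℂ)]
    rw [← sub_eq_zero.1 h] at this
    simp at this
  obtain ⟨V, hV, hVf⟩ := exists_multiplication (α := α) (β := 0) hγ fun g => by
    have h1 := norm_sub_norm_le g (γ • shift g)
    rw [norm_smul, LinearIsometry.norm_map] at h1
    rw [zero_smul, zero_add, norm_smul, LinearIsometry.norm_map]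
    nlinarith [norm_nonneg g]
  have h0 : ψ 0 = 0 := Complex.UnitDisc.coe_injective (by simpa using hψ 0)
  obtain ⟨T, hT⟩ := exists_kernel_mul_comp h0 hV fun f z => by
    refine mul_left_cancel₀ (hne z) ?_
    rw [hVf, zero_add, ← hψ]
    ring
  exact ⟨T, fun f z => by simp [hT, kernel_zero]⟩

theorem exists_isCompositionOperator_of_fixes_zero {ψ : 𝔻 → 𝔻} {α γ : ℂ}
    (hne : ∀ z : 𝔻, 1 - γ * (z : ℂ) ≠ 0)
    (hψ : ∀ z, (ψ z : ℂ) * (1 - γ * z) = α * z) :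
    ∃ T : HardySpace →L[ℂ] HardySpace, IsCompositionOperator ψ T := by
  have hγ : ‖γ‖ ≤ 1 := by
    by_contra! h
    have h0 : γ ≠ 0 := norm_pos_iff.1 (by linarith)
    refine hne (Complex.UnitDisc.mk γ⁻¹ (by rw [norm_inv]; exact inv_lt_one_of_one_lt₀ h)) ?_
    simp [h0]
  -- The direction `u` makes `|1 - γ z|` smallest on each circle; letting `|z| → 1` along it in `|ψ
  -- z| < 1` yields `|α| + |γ| ≤ 1`.
  obtain ⟨u, hu, huγ⟩ : ∃ u : ℂ, ‖u‖ = 1 ∧ γ * u = ‖γ‖ := by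
    rcases eq_or_ne γ 0 with h0 | h0
    · exact ⟨1, by simp, by simp [h0]⟩
    · have h1 : (‖γ‖ : ℂ) ≠ 0 := by simpa using h0
      refine ⟨conj γ / ‖γ‖, by simp [h0], ?_⟩
      rw [← mul_div_assoc, Complex.mul_conj', sq, mul_div_assoc, div_self h1, mul_one]
  have hr : ∀ r ∈ Set.Ioo (0 : ℝ) 1, ‖α‖ * r ≤ 1 - r * ‖γ‖ := by
    rintro r ⟨hr0, hr1⟩
    let z := Complex.UnitDisc.mk (r * u) (by simp [hu, abs_of_pos hr0, hr1])
    have h1 := congrArg norm (hψ z)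
    have h2 : γ * (z : ℂ) = ((r * ‖γ‖ : ℝ) : ℂ) := by
      simp only [z, Complex.UnitDisc.coe_mk]; push_cast; linear_combination (r : ℂ) * huγ
    have h3 : 0 ≤ 1 - r * ‖γ‖ := by nlinarith [norm_nonneg γ]
    have h4 : ‖1 - ((r * ‖γ‖ : ℝ) : ℂ)‖ = 1 - r * ‖γ‖ := by
      rw [← Complex.ofReal_one, ← Complex.ofReal_sub, Complex.norm_real, Real.norm_of_nonneg h3]
    have h5 : ‖(z : ℂ)‖ = r := by simp [z, hu, abs_of_pos hr0]
    rw [norm_mul, norm_mul, h2, h4, h5] at h1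
    rw [← h1]
    exact mul_le_of_le_one_left h3 (ψ z).norm_lt_one.le
  have hα : ‖α‖ + ‖γ‖ ≤ 1 := by
    by_contra! h
    have h0 : 0 < ‖α‖ + ‖γ‖ := by linarith
    obtain ⟨r, hr1, hr2⟩ := exists_between (inv_lt_one_of_one_lt₀ h)
    have h2 := hr r ⟨(inv_pos.2 h0).trans hr1, hr2⟩
    have h3 := (inv_lt_iff_one_lt_mul₀ h0).1 hr1
    nlinarith
  rcases hγ.lt_or_eq with h | h
  · exact exists_isCompositionOperator_of_mul_eq hα h hψ
  -- Here `ψ` is constantly 0, so `γ` may be replaced by 0.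
  · have hα0 : α = 0 := norm_le_zero_iff.1 (by linarith)
    refine exists_isCompositionOperator_of_mul_eq (α := 0) (γ := 0) (by simp) (by simp) fun z => ?_
    have := (mul_eq_zero.1 ((hψ z).trans (by simp [hα0]))).resolve_right (hne z)
    simp [this]

theorem IsLinearFractional.exists_isCompositionOperator {φ : 𝔻 → 𝔻}
    (hφ : IsLinearFractional φ) :
    ∃ T : HardySpace →L[ℂ] HardySpace, IsCompositionOperator φ T := by
  obtain ⟨a, b, c, d, h⟩ := hφ
  have hd : d ≠ 0 := by simpa using (h 0).1
  set p := φ 0 with hp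
  have hpd : (p : ℂ) * d = b := by rw [hp, (h 0).2]; simp [hd]
  set k := 1 - conj (p : ℂ) * p with hk
  have hk0 : k ≠ 0 := one_sub_conj_mul_ne_zero p p
  -- This normalizes the denominator of `discInvolution p ∘ φ`, which fixes 0, to the form `1 - γ *
  -- z`.
  have hden : ∀ z : 𝔻, (1 - conj (p : ℂ) * φ z) * (c * z + d) =
      d * k * (1 - (conj (p : ℂ) * a - c) / (d * k) * z) := by
    intro z
    have h1 := (eq_div_iff (h z).1).1 (h z).2
    have : d * k * (1 - (conj (p : ℂ) * a - c) / (d * k) * z) =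
      d * k - (conj (p : ℂ) * a - c) * z := by field_simp
    rw [this, hk]
    linear_combination (-conj (p : ℂ)) * h1 + conj (p : ℂ) * hpd
  obtain ⟨T, hT⟩ := exists_isCompositionOperator_of_fixes_zero
    (ψ := discInvolution p ∘ φ) (α := (p * c - a) / (d * k)) (γ := (conj (p : ℂ) * a - c) / (d * k))
    (fun z hz => by
      have := hden z
      rw [hz, mul_zero] at this
      exact mul_ne_zero (one_sub_conj_mul_ne_zero p (φ z)) (h z).1 this)
    (fun z => by
      have h1 := (eq_div_iff (h z).1).1 (h z).2
      refine mul_left_cancel₀ (mul_ne_zero hd hk0) ?_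
      rw [mul_left_comm, ← hden, ← mul_assoc, Function.comp_apply, discInvolution_mul]
      have h3 : d * k * ((p * c - a) / (d * k) * z) = (p * c - a) * z := by field_simp
      linear_combination hpd - h1 - h3)
  obtain ⟨U, hU⟩ := exists_isCompositionOperator_discInvolution p
  refine ⟨T * U, ?_⟩
  have := hU.mul hT
  rwa [show discInvolution p ∘ discInvolution p ∘ φ = φ from
    funext fun z => discInvolution_involutive p (φ z)] at this

/-! ### Norm identities and rigidity of the symbol -/

theorem IsCNormal.norm_apply_eq {H : Type*} [NormedAddCommGroup H] [InnerProductSpace ℂ H]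
    [CompleteSpace H] {C : Conjugation H} {T : H →L[ℂ] H} (h : IsCNormal C T) (x : H) :
    ‖T (C x)‖ = ‖adjoint T x‖ := by
  have h1 : inner ℂ (T (C x)) (T (C x)) = inner ℂ (adjoint T x) (adjoint T x) := by
    have h2 := C.inner_map_map (C x) (adjoint T (T (C x)))
    rw [adjoint_inner_left, C.involutive] at h2
    rw [adjoint_inner_left, ← h x, h2]
  rw [← ofReal_norm_sq, ← ofReal_norm_sq] at h1
  have h3 : ‖T (C x)‖ ^ 2 = ‖adjoint T x‖ ^ 2 := by exact_mod_cast h1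
  exact (sq_eq_sq₀ (norm_nonneg _) (norm_nonneg _)).1 h3

theorem conjJ_monomial (μ : Circle) (n : ℕ) :
    conjJ μ (monomial n) = (conj (μ : ℂ) ^ n) • monomial n := by
  ext z
  simp [conjJ_apply, mul_pow]

namespace IsCompositionOperator

variable {φ : 𝔻 → 𝔻} {T : HardySpace →L[ℂ] HardySpace}

theorem adjoint_kernel (hT : IsCompositionOperator φ T) (w : 𝔻) :
    adjoint T (kernel w) = kernel (φ w) :=
  ext_inner_right ℂ fun f => by
    rw [adjoint_inner_left, inner_kernel, inner_kernel, hT]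

theorem coeff_one_apply (hT : IsCompositionOperator φ T) (h0 : φ 0 = 0) (f : HardySpace) :
    (T f).coeff 1 = f.coeff 1 * (T (monomial 1)).coeff 1 := by
  have h1 := (T (monomial 1)).hasDerivAt_zero
  have h2 := HasDerivAt.comp_of_eq (0 : ℂ) f.hasDerivAt_zero h1 (by simp [hT _ _, h0])
  refine (T f).hasDerivAt_zero.unique (h2.congr_of_eventuallyEq ?_)
  filter_upwards [Metric.ball_mem_nhds (0 : ℂ) one_pos] with z hz
  have hz' : ‖z‖ < 1 := by simpa using hz
  simp [hz', hT _ _, (φ _).norm_lt_one]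

theorem eq_mul_of_norm_eq (hT : IsCompositionOperator φ T)
    (h0 : ‖T (monomial 0)‖ = ‖adjoint T (monomial 0)‖)
    (h1 : ‖T (monomial 1)‖ = ‖adjoint T (monomial 1)‖) :
    ∃ l : ℂ, ∀ z, (φ z : ℂ) = l * z := by
  have hφ : φ 0 = 0 := by
    have h2 : T (monomial 0) = monomial 0 := by ext z; simp [hT _ _]
    rw [h2, ← kernel_zero, hT.adjoint_kernel, kernel_zero, norm_monomial] at h0
    have h3 := norm_kernel_sq (φ 0)
    rw [← h0, one_pow, eq_comm, inv_eq_one] at h3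
    have h4 : ‖(φ 0 : ℂ)‖ ^ 2 = 0 := by linarith
    exact Complex.UnitDisc.coe_injective (by simpa using h4)
  set l := (T (monomial 1)).coeff 1 with hl
  have h2 : adjoint T (monomial 1) = conj l • monomial 1 := ext_inner_right ℂ fun f => by
    rw [adjoint_inner_left, inner_monomial, inner_smul_left, inner_monomial, Complex.conj_conj,
      hT.coeff_one_apply hφ, mul_comm]
  -- Expanding, `‖T z - l z‖² = |l|² - 2|l|² + |l|² = 0`.
  have h3 : T (monomial 1) = l • monomial 1 := by
    rw [← sub_eq_zero, ← norm_eq_zero, ← sq_eq_zero_iff, @norm_sub_sq ℂ, h1, h2, norm_smul,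
      norm_smul, norm_monomial, ← inner_conj_symm, inner_smul_left, inner_monomial, ← hl,
      Complex.conj_mul', RCLike.norm_conj, ← Complex.ofReal_pow, RCLike.re_eq_complex_re,
      Complex.conj_ofReal, Complex.ofReal_re]
    ring
  refine ⟨l, fun z => ?_⟩
  have h4 := congrArg (fun f : HardySpace => f z) h3
  simpa [hT _ _] using h4

theorem coeff_apply (hT : IsCompositionOperator φ T) {l : ℂ} (hl : ∀ z, (φ z : ℂ) = l * z)
    (hl1 : ‖l‖ ≤ 1) (f : HardySpace) (n : ℕ) : (T f).coeff n = l ^ n * f.coeff n := by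
  refine congrFun (coeff_eq (a := fun n => l ^ n * f.coeff n) ⟨?_, fun z => ?_⟩) n
  · refine Summable.of_nonneg_of_le (fun _ => by positivity) (fun n => ?_) f.summable_norm_coeff_sq
    rw [norm_mul, norm_pow]
    gcongr
    exact mul_le_of_le_one_left (norm_nonneg _) (pow_le_one₀ (norm_nonneg _) hl1)
  · have := f.hasCoeffs_coeff.2 (φ z)
    change HasSum _ (T f z)
    rw [hT]
    simpa [hl, mul_pow, mul_left_comm, mul_assoc] using this

end IsCompositionOperator

theorem norm_le_one_of_mul {φ : 𝔻 → 𝔻} {l : ℂ} (hl : ∀ z, (φ z : ℂ) = l * z) : ‖l‖ ≤ 1 := by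
  by_contra! h
  have h0 : l ≠ 0 := norm_pos_iff.1 (by linarith)
  have h1 := hl (Complex.UnitDisc.mk l⁻¹ (by rw [norm_inv]; exact inv_lt_one_of_one_lt₀ h))
  rw [Complex.UnitDisc.coe_mk, mul_inv_cancel₀ h0] at h1
  exact Complex.UnitDisc.coe_ne_one _ h1

end Hardy

end

/-! ### The equivalence -/

theorem mainTheorem9 (φ : Complex.UnitDisc → Complex.UnitDisc)
    (hφ : Hardy.IsLinearFractional φ) :
    (∃! T : Hardy.HardySpace →L[ℂ] Hardy.HardySpace, Hardy.IsCompositionOperator φ T) ∧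
    ∀ T : Hardy.HardySpace →L[ℂ] Hardy.HardySpace, Hardy.IsCompositionOperator φ T →
      ∀ μ : Circle,
        [IsStarNormal T, Hardy.IsCNormal Hardy.conjOne T,
          Hardy.IsCNormal (Hardy.conjJ μ) T].TFAE := by
  open Hardy HardySpace ContinuousLinearMap in
  obtain ⟨T₀, hT₀⟩ := hφ.exists_isCompositionOperator
  refine ⟨⟨T₀, hT₀, fun T hT => hT.eq hT₀⟩, fun T hT μ => ?_⟩
  have hJ : ∀ μ : Circle, IsCNormal (conjJ μ) T → ∃ l : ℂ, ∀ z, (φ z : ℂ) = l * z := by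
    intro μ h
    have key : ∀ n, ‖T (monomial n)‖ = ‖adjoint T (monomial n)‖ := fun n => by
      rw [← h.norm_apply_eq, conjJ_monomial, map_smul, norm_smul, norm_pow, RCLike.norm_conj,
        Circle.norm_coe, one_pow, one_mul]
    exact hT.eq_mul_of_norm_eq (key 0) (key 1)
  have hN : IsStarNormal T → ∃ l : ℂ, ∀ z, (φ z : ℂ) = l * z := fun h =>
    have key := isStarNormal_iff_norm_eq_adjoint.1 h
    hT.eq_mul_of_norm_eq (key _) (key _)
  have hcoeff : ∀ l : ℂ, (∀ z, (φ z : ℂ) = l * z) → ∀ (f : HardySpace) (n : ℕ),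
      (T f).coeff n = l ^ n * f.coeff n ∧
      (adjoint T f).coeff n = conj l ^ n * f.coeff n := by
    intro l hl f n
    have h := hT.coeff_apply hl (norm_le_one_of_mul hl)
    refine ⟨h f n, ?_⟩
    have h1 : T (monomial n) = l ^ n • monomial n := ext_coeff fun m => by
      rw [h, coeff_smul]
      rcases eq_or_ne m n with rfl | hm
      · rfl
      · simp [hm]
    rw [← inner_monomial, adjoint_inner_right, h1, inner_smul_left, inner_monomial, map_pow]
  have hJ' : (∃ l : ℂ, ∀ z, (φ z : ℂ) = l * z) → ∀ μ : Circle, IsCNormal (conjJ μ) T := by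
    rintro ⟨l, hl⟩ μ f
    refine ext_coeff fun n => ?_
    -- Both sides are diagonal with entries `|l| ^ (2 * n)`, once the unimodular factors of the two
    -- uses of `J_μ` cancel.
    have hμ : (μ : ℂ) ^ n * conj (μ : ℂ) ^ n = 1 := by
      rw [← mul_pow, Complex.mul_conj', Circle.norm_coe]; simp
    have hc : ∀ g n, (conjJ μ g).coeff n = conj (g.coeff n * (μ : ℂ) ^ n) := coeff_conjJFun μ
    rw [hc, (hcoeff l hl _ _).2, (hcoeff l hl _ _).1, hc, (hcoeff l hl _ _).1,
      (hcoeff l hl _ _).2]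
    simp only [map_mul, map_pow, Complex.conj_conj]
    linear_combination (l ^ n * conj l ^ n * f.coeff n) * hμ
  have hN' : (∃ l : ℂ, ∀ z, (φ z : ℂ) = l * z) → IsStarNormal T := by
    rintro ⟨l, hl⟩
    refine ⟨ContinuousLinearMap.ext fun f => ext_coeff fun n => ?_⟩
    change (adjoint T (T f)).coeff n = (T (adjoint T f)).coeff n
    rw [(hcoeff l hl _ _).2, (hcoeff l hl _ _).1, (hcoeff l hl _ _).1, (hcoeff l hl _ _).2]
    ring
  tfae_have 1 → 2 := fun h => hJ' (hN h) 1
  tfae_have 2 → 3 := fun h => hJ' (hJ 1 h) μ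
  tfae_have 3 → 1 := fun h => hN' (hJ μ h)
  tfae_finish
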